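/- Let $f_m := \prod_{n=1}^{\infty}(1-q^{mn})$ for a positive integer $m$, and let the integers $P^\ast(n)$, $n\ge0$, be defined by $$\sum_{n=0}^\infty P^\ast(n)q^n = f_1^4f_5^4 .$$ For all integers $k\ge 0$ and $n\ge -1$, we have \begin{align*} P^\ast(2^{4k}n+2^{4k+1}-1)&\equiv 0\pmod{2^{6k}},\\ P^\ast(2^{4k+1}n+2^{4k+2}-1)&\equiv 0\pmod{2^{6k+2}},\\ P^\ast(2^{4k+2}n+2^{4k+3}-1)&\equiv 0\pmod{2^{6k+3}},\\ P^\ast(2^{4k+3}n+2^{4k+4}-1)&\equiv 0\pmod{2^{6k+6}},\\ P^\ast(2^{4k+4}n+3\cdot 2^{4k+3}-1)&=0. \end{align*} -/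

import Mathlib

namespace RestrictedPartitions

open PowerSeries
open scoped PowerSeries.WithPiTopology

/-- The Euler product `f_m = ∏_{n ≥ 1} (1 - q^{mn})` as a formal power series in `q` with integer
coefficients. The infinite product converges coefficientwise for every `m ≥ 1`, see
`multipliable_eulerProd`. -/
noncomputable def eulerProd (m : ℕ) : PowerSeries ℤ :=
  ∏' n : ℕ, ((1 : PowerSeries ℤ) - X ^ (m * (n + 1)))

/-- For `m ≥ 1` the infinite product in the definition of `eulerProd m` converges. -/
theorem multipliable_eulerProd (m : ℕ) (hm : 1 ≤ m) :
    Multipliable fun n : ℕ => (1 : PowerSeries ℤ) - X ^ (m * (n + 1)) := by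
  simp_rw [sub_eq_add_neg]
  apply PowerSeries.WithPiTopology.multipliable_one_add_of_tendsto_order_atTop_nhds_top
  refine ENat.tendsto_nhds_top_iff_natCast_lt.mpr fun N => Filter.eventually_atTop.mpr ⟨N, ?_⟩
  intro n hn
  rw [PowerSeries.order_neg, PowerSeries.order_X_pow]
  have : N < m * (n + 1) := by nlinarith
  exact_mod_cast this

/-- `P*(n)` is the coefficient of `q^n` in `f_1^4 f_5^4`. -/
noncomputable def PStar (n : ℕ) : ℤ :=
  PowerSeries.coeff n (eulerProd 1 ^ 4 * eulerProd 5 ^ 4)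

end RestrictedPartitions

/-! Let `a(n)` be the coefficients of `q f_1^4 f_5^4`, so `a(n) = P*(n - 1)`. Everything follows
from the Hecke relation `a(2n) = -4 a(n) - 8 a(n/2)`, with `a(n/2) = 0` for odd `n`. The recurrence
has characteristic polynomial `x^2 + 4x + 8`, whose roots `-2 ± 2i` have fourth power `-64`; hence
`a(16n) = -64 a(n)`, and `a(8n) = 0` for odd `n`.

The relation itself is proved by theta functions, without modular forms. Gauss' `f_1^2 = f_2 φ(-q)`
(`eulerProd_one_sq`) and the 2-dissection of `φ^2` give the odd part of `f_1^4 f_5^4`. That part is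
identified through `f_1 f_5 = ψ(q^2) φ(q^5) - q φ(q) ψ(q^10)` (`eulerProd_mul_dilate_five`), `ψ^2 =
φ ψ(q^2)` and `ψ f_1 = f_2^2`. -/

namespace RestrictedPartitions

open PowerSeries Filter Topology
open scoped PowerSeries.WithPiTopology

/-! ### Sums of monomials, and the substitution `q ↦ q^k`. -/

section Summation

/-- A family of monomials whose exponents have finite sublevel sets is summable. -/
theorem summable_monomial {ι : Type*} {e : ι → ℕ} (w : ι → ℤ)
    (he : ∀ n, {i | e i ≤ n}.Finite) :
    Summable fun i => monomial (e i) (w i) := by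
  rw [WithPiTopology.summable_iff_summable_coeff]
  intro d
  refine summable_of_hasFiniteSupport ((he d).subset fun i hi => ?_)
  rw [Function.mem_support, coeff_monomial] at hi
  by_contra h
  exact hi (if_neg fun h' => h h'.ge)

theorem finite_add_le {ι κ : Type*} {e : ι → ℕ} {e' : κ → ℕ}
    (he : ∀ n, {i | e i ≤ n}.Finite) (he' : ∀ n, {i | e' i ≤ n}.Finite) (n : ℕ) :
    {x : ι × κ | e x.1 + e' x.2 ≤ n}.Finite := by
  refine Set.Finite.subset (Set.Finite.prod (he n) (he' n)) fun x hx => ?_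
  have hx' : e x.1 + e' x.2 ≤ n := hx
  exact ⟨show e x.1 ≤ n by omega, show e' x.2 ≤ n by omega⟩

theorem hasSum_monomial_mul {ι κ : Type*} {e : ι → ℕ} {w : ι → ℤ} {e' : κ → ℕ} {w' : κ → ℤ}
    {A B : PowerSeries ℤ} (he : ∀ n, {i | e i ≤ n}.Finite) (he' : ∀ n, {i | e' i ≤ n}.Finite)
    (hA : HasSum (fun i => monomial (e i) (w i)) A)
    (hB : HasSum (fun i => monomial (e' i) (w' i)) B) :
    HasSum (fun x : ι × κ => monomial (e x.1 + e' x.2) (w x.1 * w' x.2)) (A * B) := by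
  have hs : Summable fun x : ι × κ =>
      monomial (R := ℤ) (e x.1) (w x.1) * monomial (e' x.2) (w' x.2) :=
    (summable_monomial (fun x : ι × κ => w x.1 * w' x.2) (finite_add_le he he')).congr
      fun x => (monomial_mul_monomial _ _ _ _).symm
  have h := HasSum.mul hA hB hs
  refine h.congr_fun fun x => ?_
  rw [monomial_mul_monomial]

theorem two_mul_left_cancel {f g : PowerSeries ℤ} (h : 2 * f = 2 * g) : f = g := by
  ext n
  have := congrArg (coeff n) h
  simp only [two_mul, map_add] at this
  omega

theorem hasSum_add_of_ranges {ι κ μ M : Type*} [AddCommMonoid M] [TopologicalSpace M]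
    [ContinuousAdd M] {f : ι → M} {i : κ → ι} {j : μ → ι} {a b : M}
    (hi : Function.Injective i) (hj : Function.Injective j) (hij : ∀ x y, i x ≠ j y)
    (hc : ∀ z, (∃ x, i x = z) ∨ ∃ y, j y = z) (ha : HasSum (fun x => f (i x)) a)
    (hb : HasSum (fun x => f (j x)) b) : HasSum f (a + b) := by
  refine HasSum.add_isCompl (s := Set.range i) (t := Set.range j) ⟨?_, ?_⟩
    (hi.hasSum_range_iff.2 ha) (hj.hasSum_range_iff.2 hb)
  · rw [Set.disjoint_left]
    rintro _ ⟨x, rfl⟩ ⟨y, hy⟩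
    exact hij x y hy.symm
  · rw [codisjoint_iff]
    exact Set.eq_univ_of_forall hc

theorem continuous_expand (k : ℕ) (hk : k ≠ 0) :
    Continuous (expand k hk : PowerSeries ℤ →ₐ[ℤ] PowerSeries ℤ) := by
  rw [continuous_iff_continuousAt]
  intro f
  rw [ContinuousAt, WithPiTopology.tendsto_iff_coeff_tendsto]
  intro d
  simp_rw [coeff_expand]
  split_ifs
  · exact (WithPiTopology.continuous_coeff ℤ _).tendsto f
  · exact tendsto_const_nhds

end Summation

/-- The substitution `q ↦ q ^ k`. -/
noncomputable abbrev dilate (k : ℕ) [NeZero k] : PowerSeries ℤ →ₐ[ℤ] PowerSeries ℤ :=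
  expand k (NeZero.ne k)

theorem dilate_dilate (k l : ℕ) [NeZero k] [NeZero l] [NeZero (k * l)] (f : PowerSeries ℤ) :
    dilate k (dilate l f) = dilate (k * l) f :=
  (expand_mul k _ l _ f).symm

theorem hasSum_dilate {ι : Type*} {e : ι → ℕ} {w : ι → ℤ} {A : PowerSeries ℤ} (k : ℕ) [NeZero k]
    (hA : HasSum (fun i => monomial (e i) (w i)) A) :
    HasSum (fun i => monomial (k * e i) (w i)) (dilate k A) := by
  simpa [Function.comp_def] using hA.map (dilate k) (continuous_expand k _)

theorem eulerProd_eq_dilate (m : ℕ) [NeZero m] : eulerProd m = dilate m (eulerProd 1) := by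
  rw [eulerProd, eulerProd, (multipliable_eulerProd 1 le_rfl).map_tprod _ (continuous_expand m _)]
  simp [pow_mul]

theorem hasSum_eulerProd_one :
    HasSum (fun k : ℤ => monomial (pentagonal k) (k.negOnePow : ℤ)) (eulerProd 1) := by
  have h := WithPiTopology.hasSum_pentagonalSeries ℤ
  rw [← WithPiTopology.tprod_one_sub_X_pow ℤ] at h
  simp only [eulerProd, one_mul]
  convert h using 2 with k
  rw [monomial_eq_C_mul_X_pow]
  simp

theorem finite_pentagonal_le (n : ℕ) : {k | pentagonal k ≤ n}.Finite :=
  (Set.finite_Iic n).preimage pentagonal_injective.injOn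

/-! ### Theta functions `φ` and `ψ` and their quadratic relations. -/

/-- The triangular number `n (n + 1) / 2` for an integer `n`. -/
def triangular (n : ℤ) : ℕ := (n * (n + 1) / 2).toNat

theorem two_mul_triangular (n : ℤ) : 2 * (triangular n : ℤ) = n * (n + 1) := by
  have h : (0 : ℤ) ≤ n * (n + 1) := by
    rcases le_or_gt 0 n with h | h <;> nlinarith
  rw [triangular, Int.toNat_of_nonneg (Int.ediv_nonneg h (by norm_num)),
    Int.mul_ediv_cancel' (Int.even_mul_succ_self n).two_dvd]

theorem triangular_neg_add_one (n : ℤ) : triangular (-(n + 1)) = triangular n := by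
  have h1 := two_mul_triangular (-(n + 1))
  have h2 := two_mul_triangular n
  zify; linarith

theorem finite_triangular_le (n : ℕ) : {k : ℤ | triangular k ≤ n}.Finite := by
  refine (Set.finite_Icc (-(2 * n + 1) : ℤ) (2 * n + 1)).subset fun k hk => ?_
  have h := two_mul_triangular k
  have hk' : (triangular k : ℤ) ≤ n := by exact_mod_cast hk
  constructor <;> nlinarith

theorem finite_natAbs_sq_le (n : ℕ) : {k : ℤ | k.natAbs ^ 2 ≤ n}.Finite := by
  refine (Set.finite_Icc (-n : ℤ) n).subset fun k hk => ?_
  have hk' : k ^ 2 ≤ n := by rw [← Int.natAbs_sq]; exact_mod_cast hk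
  constructor <;> nlinarith

theorem finite_mul_le {ι : Type*} {e : ι → ℕ} (he : ∀ n, {i | e i ≤ n}.Finite) (k : ℕ) [NeZero k]
    (n : ℕ) : {i | k * e i ≤ n}.Finite :=
  (he n).subset fun i hi => (Nat.le_mul_of_pos_left (e i) (NeZero.pos k)).trans hi

/-- Ramanujan's theta function `φ(q) = ∑ q^(n^2)` over all integers `n`. -/
noncomputable def phi : PowerSeries ℤ := ∑' n : ℤ, monomial (n.natAbs ^ 2) 1

/-- Ramanujan's theta function `ψ(q) = ∑ q^(n(n+1)/2)` over `n ≥ 0`. -/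
noncomputable def psi : PowerSeries ℤ := ∑' n : ℕ, monomial (triangular n) 1

theorem hasSum_phi : HasSum (fun n : ℤ => monomial (n.natAbs ^ 2) (1 : ℤ)) phi :=
  (summable_monomial _ finite_natAbs_sq_le).hasSum

theorem finite_triangular_natCast_le (n : ℕ) : {k : ℕ | triangular k ≤ n}.Finite :=
  Set.Finite.subset ((finite_triangular_le n).preimage Nat.cast_injective.injOn) fun _ hk => hk

theorem hasSum_psi : HasSum (fun n : ℕ => monomial (triangular n) (1 : ℤ)) psi :=
  (summable_monomial _ finite_triangular_natCast_le).hasSum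

theorem hasSum_two_mul_psi :
    HasSum (fun n : ℤ => monomial (triangular n) (1 : ℤ)) (2 * psi) := by
  rw [two_mul]
  refine HasSum.of_nat_of_neg_add_one hasSum_psi ?_
  simpa only [triangular_neg_add_one] using hasSum_psi

/-- The reflection `n ↦ -(n + 1)` fixes the exponent and flips the sign, so the terms cancel in
pairs. -/
theorem hasSum_negOnePow_triangular :
    HasSum (fun n : ℤ => monomial (triangular n) (n.negOnePow : ℤ)) 0 := by
  have h : HasSum (fun n : ℕ => monomial (triangular n) ((n : ℤ).negOnePow : ℤ))
      (∑' n : ℕ, monomial (triangular n) ((n : ℤ).negOnePow : ℤ)) :=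
    (summable_monomial _ finite_triangular_natCast_le).hasSum
  rw [← add_neg_cancel (∑' n : ℕ, monomial (triangular n) ((n : ℤ).negOnePow : ℤ))]
  refine HasSum.of_nat_of_neg_add_one h ?_
  refine h.neg.congr_fun fun n => ?_
  rw [triangular_neg_add_one, Int.negOnePow_neg, Int.negOnePow_succ, ← map_neg]
  simp

theorem hasSum_X_pow_mul {ι : Type*} {e : ι → ℕ} {w : ι → ℤ} {A : PowerSeries ℤ} (k : ℕ)
    (hA : HasSum (fun i => monomial (e i) (w i)) A) :
    HasSum (fun i => monomial (k + e i) (w i)) (X ^ k * A) := by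
  have h := hA.mul_left (X ^ k)
  simpa [X_pow_eq, monomial_mul_monomial] using h

theorem phi_eq : phi = dilate 4 phi + 2 * X * dilate 8 psi := by
  have h1 := hasSum_dilate 4 hasSum_phi
  have h2 := hasSum_X_pow_mul 1 (hasSum_dilate 8 hasSum_two_mul_psi)
  have h3 := hasSum_add_of_ranges (f := fun n : ℤ => monomial (n.natAbs ^ 2) (1 : ℤ))
    (i := fun n : ℤ => 2 * n) (j := fun n : ℤ => 2 * n + 1)
    (fun a b h => by simpa using h) (fun a b h => by simpa using h)
    (fun x y => by omega) (fun z => by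
      rcases Int.even_or_odd' z with ⟨c, h | h⟩
      · exact .inl ⟨c, h.symm⟩
      · exact .inr ⟨c, h.symm⟩)
    (h1.congr_fun fun n => ?_) (h2.congr_fun fun n => ?_)
  · have h4 := hasSum_phi.unique h3
    simp only [map_mul, map_ofNat] at h4
    linear_combination h4
  · congr 2
    zify
    simp only [sq_abs]
    ring
  · congr 2
    have := two_mul_triangular n
    zify
    simp only [sq_abs]
    linarith

theorem exists_add_sub_or (z : ℤ × ℤ) :
    (∃ x : ℤ × ℤ, (x.1 + x.2, x.1 - x.2) = z) ∨ ∃ x : ℤ × ℤ, (x.1 + x.2 + 1, x.1 - x.2) = z := by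
  obtain ⟨a, b⟩ := z
  rcases Int.even_or_odd' (a + b) with ⟨c, h | h⟩
  · exact .inl ⟨(c, a - c), by ext <;> dsimp only <;> omega⟩
  · exact .inr ⟨(c, c - b), by ext <;> dsimp only <;> omega⟩

/-- Splits the lattice by the parity of the coordinate sum. In the new coordinates the exponents of
`φ^2` and `ψ^2` have no cross term, so each class factors as a product of theta series. -/
theorem hasSum_of_add_sub {M : Type*} [AddCommMonoid M] [TopologicalSpace M]
    [ContinuousAdd M] {f : ℤ × ℤ → M} {a b : M}
    (ha : HasSum (fun x : ℤ × ℤ => f (x.1 + x.2, x.1 - x.2)) a)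
    (hb : HasSum (fun x : ℤ × ℤ => f (x.1 + x.2 + 1, x.1 - x.2)) b) : HasSum f (a + b) := by
  refine hasSum_add_of_ranges ?_ ?_ ?_ exists_add_sub_or ha hb
  · rintro ⟨a, b⟩ ⟨c, d⟩ h
    simp only [Prod.mk.injEq] at h ⊢
    omega
  · rintro ⟨a, b⟩ ⟨c, d⟩ h
    simp only [Prod.mk.injEq] at h ⊢
    omega
  · rintro ⟨a, b⟩ ⟨c, d⟩ h
    simp only [Prod.mk.injEq] at h
    omega

theorem phi_sq : phi ^ 2 = dilate 2 phi ^ 2 + 4 * X * dilate 4 psi ^ 2 := by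
  have h := hasSum_monomial_mul finite_natAbs_sq_le finite_natAbs_sq_le hasSum_phi hasSum_phi
  have h1 := hasSum_dilate 2 h
  have h2 := hasSum_X_pow_mul 1 (hasSum_dilate 4 (hasSum_monomial_mul finite_triangular_le
    finite_triangular_le hasSum_two_mul_psi hasSum_two_mul_psi))
  have h3 := hasSum_of_add_sub
    (f := fun x : ℤ × ℤ => monomial (x.1.natAbs ^ 2 + x.2.natAbs ^ 2) ((1 : ℤ) * 1))
    (h1.congr_fun fun n => ?_) (h2.congr_fun fun n => ?_)
  · rw [sq, h.unique h3]
    simp only [map_mul, map_ofNat]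
    ring
  · congr 2
    zify
    simp only [sq_abs]
    ring
  · congr 2
    have := two_mul_triangular n.1
    have := two_mul_triangular n.2
    zify
    simp only [sq_abs]
    linarith

theorem psi_sq : psi ^ 2 = phi * dilate 2 psi := by
  have h := hasSum_monomial_mul finite_triangular_le
    finite_triangular_le hasSum_two_mul_psi hasSum_two_mul_psi
  have h1 := hasSum_monomial_mul (finite_mul_le finite_triangular_le 2) finite_natAbs_sq_le
    (hasSum_dilate 2 hasSum_two_mul_psi) hasSum_phi
  have h2 := hasSum_monomial_mul (e := fun n : ℤ => (n + 1).natAbs ^ 2) (w := fun _ => 1)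
    (fun n => (finite_natAbs_sq_le n).preimage (Equiv.addRight (1 : ℤ)).injective.injOn)
    (finite_mul_le finite_triangular_le 2)
    ((Equiv.addRight (1 : ℤ)).hasSum_iff.2 hasSum_phi) (hasSum_dilate 2 hasSum_two_mul_psi)
  have h3 := hasSum_of_add_sub
    (f := fun x : ℤ × ℤ => monomial (triangular x.1 + triangular x.2) ((1 : ℤ) * 1))
    (h1.congr_fun fun n => ?_) (h2.congr_fun fun n => ?_)
  · have h4 := h.unique h3
    simp only [map_mul, map_ofNat] at h4
    refine two_mul_left_cancel (two_mul_left_cancel ?_)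
    linear_combination h4
  · congr 2
    have := two_mul_triangular n.1
    have := two_mul_triangular (n.1 + n.2)
    have := two_mul_triangular (n.1 - n.2)
    zify
    simp only [sq_abs]
    linarith
  · congr 2
    have := two_mul_triangular n.2
    have := two_mul_triangular (n.1 + n.2 + 1)
    have := two_mul_triangular (n.1 - n.2)
    zify
    simp only [sq_abs]
    linarith

/-! ### The level five relation: one double theta series summed in two ways. -/

/-- Four times the exponent is `(2t + 1 - y)^2 + 5 y^2 - 1`. -/
def levelFiveExponent (x : ℤ × ℤ) : ℕ :=
  (((2 * x.1 + 1 - x.2) ^ 2 + 5 * x.2 ^ 2 - 1) / 4).toNat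

theorem four_mul_levelFiveExponent (t y : ℤ) :
    4 * (levelFiveExponent (t, y) : ℤ) = (2 * t + 1 - y) ^ 2 + 5 * y ^ 2 - 1 := by
  have h : 0 ≤ (2 * t + 1 - y) ^ 2 + 5 * y ^ 2 - 1 := by
    rcases eq_or_ne y 0 with rfl | hy
    · have : 0 < (2 * t + 1 - 0) ^ 2 := by
        have : 2 * t + 1 - 0 ≠ 0 := by omega
        positivity
      linarith
    · have : 0 < y ^ 2 := by positivity
      nlinarith [sq_nonneg (2 * t + 1 - y)]
  have h4 : (4 : ℤ) ∣ (2 * t + 1 - y) ^ 2 + 5 * y ^ 2 - 1 := by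
    obtain ⟨c, hc⟩ := Int.even_mul_succ_self (y - 1)
    exact ⟨t ^ 2 + t - t * y + y ^ 2 + c, by linear_combination 2 * hc⟩
  rw [levelFiveExponent, Int.toNat_of_nonneg (Int.ediv_nonneg h (by norm_num)),
    Int.mul_ediv_cancel' h4]

/-- First evaluation: split by the parity of `y`, which also fixes the sign. -/
theorem hasSum_levelFive_theta :
    HasSum (fun x : ℤ × ℤ => monomial (levelFiveExponent x) (x.2.negOnePow : ℤ))
      (dilate 2 (2 * psi) * dilate 5 phi + -(X ^ 1 * (phi * dilate 10 (2 * psi)))) := by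
  have h1 := hasSum_monomial_mul
    (finite_mul_le finite_triangular_le 2)
    (finite_mul_le finite_natAbs_sq_le 5) (hasSum_dilate 2 hasSum_two_mul_psi)
    (hasSum_dilate 5 hasSum_phi)
  have h2 := (hasSum_X_pow_mul 1 (hasSum_monomial_mul finite_natAbs_sq_le
    (finite_mul_le finite_triangular_le 10) hasSum_phi
    (hasSum_dilate 10 hasSum_two_mul_psi))).neg
  refine hasSum_add_of_ranges (i := fun x : ℤ × ℤ => (x.1 + x.2, 2 * x.2))
    (j := fun x : ℤ × ℤ => (x.1 + x.2, 2 * x.2 + 1)) ?_ ?_ ?_ ?_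
    (h1.congr_fun fun x => ?_) (h2.congr_fun fun x => ?_)
  · rintro ⟨a, b⟩ ⟨c, d⟩ h
    simp only [Prod.mk.injEq] at h ⊢
    omega
  · rintro ⟨a, b⟩ ⟨c, d⟩ h
    simp only [Prod.mk.injEq] at h ⊢
    omega
  · rintro ⟨a, b⟩ ⟨c, d⟩ h
    simp only [Prod.mk.injEq] at h
    omega
  · rintro ⟨t, y⟩
    rcases Int.even_or_odd' y with ⟨c, h | h⟩
    · exact .inl ⟨(t - c, c), by ext <;> dsimp only <;> omega⟩
    · exact .inr ⟨(t - c, c), by ext <;> dsimp only <;> omega⟩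
  · have he : levelFiveExponent (x.1 + x.2, 2 * x.2) =
        2 * triangular x.1 + 5 * x.2.natAbs ^ 2 := by
      have := four_mul_levelFiveExponent (x.1 + x.2) (2 * x.2)
      have := two_mul_triangular x.1
      zify
      simp only [sq_abs]
      linarith
    rw [he, Int.negOnePow_two_mul]
    simp
  · have he : levelFiveExponent (x.1 + x.2, 2 * x.2 + 1) =
        1 + (x.1.natAbs ^ 2 + 10 * triangular x.2) := by
      have := four_mul_levelFiveExponent (x.1 + x.2) (2 * x.2 + 1)
      have := two_mul_triangular x.2
      zify
      simp only [sq_abs]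
      linarith
    rw [he, Int.negOnePow_two_mul_add_one, ← map_neg]
    simp

/-- Second evaluation: split by `t` modulo 3. The classes 0 and 2 each give `f_1 f_5` by the
pentagonal number theorem; the class 1 vanishes, being a multiple of an alternating triangular
series. -/
theorem hasSum_levelFive_eulerProd :
    HasSum (fun x : ℤ × ℤ => monomial (levelFiveExponent x) (x.2.negOnePow : ℤ))
      (eulerProd 1 * dilate 5 (eulerProd 1) + eulerProd 1 * dilate 5 (eulerProd 1) + X ^ 2 * 0) := by
  have h1 := hasSum_monomial_mul finite_pentagonal_le (finite_mul_le finite_pentagonal_le 5)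
    hasSum_eulerProd_one (hasSum_dilate 5 hasSum_eulerProd_one)
  have h3 := hasSum_X_pow_mul 2 (hasSum_monomial_mul (finite_mul_le finite_triangular_le 3)
    (finite_mul_le finite_triangular_le 15) (hasSum_dilate 3 hasSum_negOnePow_triangular)
    (hasSum_dilate 15 hasSum_negOnePow_triangular))
  rw [map_zero, zero_mul] at h3
  -- These substitutions parametrise the three classes and cancel the cross term of the quadratic
  -- form.
  refine hasSum_add_of_ranges
    (i := Sum.elim (fun x : ℤ × ℤ => (-3 * x.2, x.1 - x.2))
      (fun x : ℤ × ℤ => (3 * x.2 - 1, x.2 - x.1)))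
    (j := fun x : ℤ × ℤ => (3 * x.2 + 1, x.2 - x.1)) ?_ ?_ ?_ ?_
    (hasSum_add_of_ranges Sum.inl_injective Sum.inr_injective (fun _ _ => Sum.inl_ne_inr)
      ?_ (h1.congr_fun fun x => ?_) (h1.congr_fun fun x => ?_)) (h3.congr_fun fun x => ?_)
  · rintro (⟨a, b⟩ | ⟨a, b⟩) (⟨c, d⟩ | ⟨c, d⟩) h <;>
      simp only [Sum.elim_inl, Sum.elim_inr, Prod.mk.injEq, Sum.inl.injEq, Sum.inr.injEq,
        reduceCtorEq] at h ⊢ <;> omega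
  · rintro ⟨a, b⟩ ⟨c, d⟩ h
    simp only [Prod.mk.injEq] at h ⊢
    omega
  · rintro (⟨a, b⟩ | ⟨a, b⟩) ⟨c, d⟩ h <;>
      simp only [Sum.elim_inl, Sum.elim_inr, Prod.mk.injEq] at h <;> omega
  · rintro ⟨t, y⟩
    have ht : t % 3 = 0 ∨ t % 3 = 2 ∨ t % 3 = 1 := by omega
    rcases ht with h | h | h
    · refine .inl ⟨.inl (y - t / 3, -(t / 3)), ?_⟩
      ext <;> simp only [Sum.elim_inl] <;> omega
    · refine .inl ⟨.inr ((t + 1) / 3 - y, (t + 1) / 3), ?_⟩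
      ext <;> simp only [Sum.elim_inr] <;> omega
    · refine .inr ⟨(t / 3 - y, t / 3), ?_⟩
      ext <;> dsimp only <;> omega
  · rintro (x | x)
    · exact .inl ⟨x, rfl⟩
    · exact .inr ⟨x, rfl⟩
  · have he : levelFiveExponent (-3 * x.2, x.1 - x.2) = pentagonal x.1 + 5 * pentagonal x.2 := by
      have := four_mul_levelFiveExponent (-3 * x.2) (x.1 - x.2)
      have := two_mul_natCast_pentagonal x.1
      have := two_mul_natCast_pentagonal x.2
      zify
      linarith
    simp only [Sum.elim_inl]
    rw [he, Int.negOnePow_sub, Units.val_mul]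
  · have he : levelFiveExponent (3 * x.2 - 1, x.2 - x.1) =
        pentagonal x.1 + 5 * pentagonal x.2 := by
      have := four_mul_levelFiveExponent (3 * x.2 - 1) (x.2 - x.1)
      have := two_mul_natCast_pentagonal x.1
      have := two_mul_natCast_pentagonal x.2
      zify
      linarith
    simp only [Sum.elim_inr]
    rw [he, Int.negOnePow_sub, Units.val_mul, mul_comm (x.2.negOnePow : ℤ)]
  · have he : levelFiveExponent (3 * x.2 + 1, x.2 - x.1) =
        2 + (3 * triangular x.1 + 15 * triangular x.2) := by
      have := four_mul_levelFiveExponent (3 * x.2 + 1) (x.2 - x.1)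
      have := two_mul_triangular x.1
      have := two_mul_triangular x.2
      zify
      linarith
    rw [he, Int.negOnePow_sub, Units.val_mul, mul_comm (x.2.negOnePow : ℤ)]

/-- The level five relation `f_1 f_5 = ψ(q^2) φ(q^5) - q φ(q) ψ(q^10)`. -/
theorem eulerProd_mul_dilate_five :
    eulerProd 1 * dilate 5 (eulerProd 1) = dilate 2 psi * dilate 5 phi - X * phi * dilate 10 psi := by
  have h := hasSum_levelFive_theta.unique hasSum_levelFive_eulerProd
  simp only [map_mul, map_ofNat] at h
  refine two_mul_left_cancel ?_
  linear_combination -h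

/-! ### Gauss' triangular number identity, from Shanks' finite form. -/

section Shanks

variable {R : Type*} [CommRing R]

/-- The terms of Shanks' finite form of Gauss' triangular number identity. -/
def shanksTerm (x : R) (n s : ℕ) : R :=
  (∏ i ∈ Finset.Ico s n, (1 - x ^ (2 * i + 2))) * (∏ i ∈ Finset.range s, (1 - x ^ (2 * i + 1))) *
    x ^ (s * (2 * n + 1))

theorem shanksTerm_succ_right (x : R) {n m : ℕ} (h : m < n) :
    (1 - x ^ (2 * m + 2)) * shanksTerm x n (m + 1) =
      (1 - x ^ (2 * m + 1)) * x ^ (2 * n + 1) * shanksTerm x n m := by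
  rw [shanksTerm, shanksTerm, Finset.prod_eq_prod_Ico_succ_bot h, Finset.prod_range_succ, add_mul,
    pow_add]
  ring

theorem shanksTerm_succ_left (x : R) {n s : ℕ} (h : s ≤ n) :
    shanksTerm x (n + 1) s = (1 - x ^ (2 * n + 2)) * x ^ (2 * s) * shanksTerm x n s := by
  rw [shanksTerm, shanksTerm, Finset.prod_Ico_succ_top h,
    show s * (2 * (n + 1) + 1) = 2 * s + s * (2 * n + 1) by ring, pow_add]
  ring

/-- The weights are the discrepancy between the terms for `n + 1` and `1 - x ^ (2 * n + 1)` times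
those for `n`; this sum drives the induction in `sum_pow_triangular_mul_prod`. -/
theorem sum_shanksTerm_telescope (x : R) (n m : ℕ) (h : m ≤ n) :
    ∑ s ∈ Finset.range (m + 1),
        ((1 - x ^ (2 * s)) - x ^ (2 * n + 1) * (1 - x ^ (2 * s + 1))) * shanksTerm x n s =
      -(x ^ (2 * n + 1) * (1 - x ^ (2 * m + 1))) * shanksTerm x n m := by
  induction m with
  | zero => simp
  | succ m ih =>
    rw [Finset.sum_range_succ, ih (by omega)]
    have := shanksTerm_succ_right x (show m < n by omega)
    rw [show 2 * (m + 1) = 2 * m + 2 by ring]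
    linear_combination this

theorem sum_pow_triangular_mul_prod (x : R) (n : ℕ) :
    (∑ k ∈ Finset.range (2 * n), x ^ triangular k) *
      ∏ i ∈ Finset.range n, (1 - x ^ (2 * i + 1)) = ∑ s ∈ Finset.range n, shanksTerm x n s := by
  induction n with
  | zero => simp
  | succ n ih =>
    have h0 : triangular ((2 * n : ℕ) : ℤ) = n * (2 * n + 1) := by
      have := two_mul_triangular (2 * n : ℕ)
      zify
      push_cast at this
      linarith
    have h1 : triangular ((2 * n + 1 : ℕ) : ℤ) = n * (2 * n + 1) + (2 * n + 1) := by
      have := two_mul_triangular (2 * n + 1 : ℕ)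
      zify
      push_cast at this
      linarith
    have hn : shanksTerm x n n = (∏ i ∈ Finset.range n, (1 - x ^ (2 * i + 1))) *
        x ^ (n * (2 * n + 1)) := by simp [shanksTerm]
    have hs : ∑ s ∈ Finset.range (n + 1), shanksTerm x (n + 1) s =
        (1 - x ^ (2 * n + 1)) * ∑ s ∈ Finset.range (n + 1), shanksTerm x n s -
        ∑ s ∈ Finset.range (n + 1),
          ((1 - x ^ (2 * s)) - x ^ (2 * n + 1) * (1 - x ^ (2 * s + 1))) * shanksTerm x n s := by
      rw [Finset.mul_sum, ← Finset.sum_sub_distrib]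
      refine Finset.sum_congr rfl fun s hs => ?_
      rw [shanksTerm_succ_left x (Nat.lt_succ_iff.1 (Finset.mem_range.1 hs))]
      ring
    rw [hs, sum_shanksTerm_telescope x n n le_rfl, Finset.sum_range_succ, ← ih,
      show 2 * (n + 1) = 2 * n + 1 + 1 by ring, Finset.sum_range_succ, Finset.sum_range_succ,
      Finset.prod_range_succ, h0, h1, hn, pow_add]
    ring

end Shanks

theorem tendsto_zero_of_X_pow_dvd {f : ℕ → PowerSeries ℤ} (h : ∀ n, X ^ n ∣ f n) :
    Tendsto f atTop (𝓝 0) := by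
  rw [WithPiTopology.tendsto_iff_coeff_tendsto]
  intro d
  refine tendsto_atTop_of_eventually_const (i₀ := d + 1) fun n hn => ?_
  rw [map_zero]
  exact X_pow_dvd_iff.1 (h n) d hn

theorem multipliable_one_sub_X_pow_odd :
    Multipliable fun n : ℕ => (1 : PowerSeries ℤ) - X ^ (2 * n + 1) := by
  simp_rw [sub_eq_add_neg]
  apply WithPiTopology.multipliable_one_add_of_tendsto_order_atTop_nhds_top
  refine ENat.tendsto_nhds_top_iff_natCast_lt.mpr fun N => eventually_atTop.mpr ⟨N, fun n hn => ?_⟩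
  rw [order_neg, order_X_pow]
  have : N < 2 * n + 1 := by omega
  exact_mod_cast this

theorem eulerProd_one_eq_mul :
    eulerProd 1 = (∏' n : ℕ, ((1 : PowerSeries ℤ) - X ^ (2 * n + 1))) * eulerProd 2 := by
  have h := HasProd.even_mul_odd (f := fun n : ℕ => (1 : PowerSeries ℤ) - X ^ (n + 1))
    multipliable_one_sub_X_pow_odd.hasProd (multipliable_eulerProd 2 (by norm_num)).hasProd
  simpa [eulerProd] using h.tprod_eq

/-- Gauss' identity `ψ(q) f_1 = f_2 ^ 2`. -/
theorem psi_mul_eulerProd_one : psi * eulerProd 1 = eulerProd 2 ^ 2 := by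
  have h1 : Tendsto (fun n : ℕ => (∑ k ∈ Finset.range (2 * n), X ^ triangular k) *
      ∏ i ∈ Finset.range n, ((1 : PowerSeries ℤ) - X ^ (2 * i + 1))) atTop
      (𝓝 (psi * ∏' n : ℕ, ((1 : PowerSeries ℤ) - X ^ (2 * n + 1)))) := by
    refine Tendsto.mul ?_ multipliable_one_sub_X_pow_odd.hasProd.tendsto_prod_nat
    have h := hasSum_psi.tendsto_sum_nat
    simp_rw [← X_pow_eq] at h
    exact h.comp (tendsto_atTop_mono (fun n => by simp only [id]; omega) tendsto_id)
  have h2 : Tendsto (fun n : ℕ => ∑ s ∈ Finset.range n, shanksTerm (X : PowerSeries ℤ) n s) atTop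
      (𝓝 (eulerProd 2)) := by
    have h : Tendsto (fun n : ℕ => ∑ s ∈ Finset.range n, shanksTerm (X : PowerSeries ℤ) n s -
        ∏ i ∈ Finset.range n, (1 - X ^ (2 * (i + 1)))) atTop (𝓝 0) := by
      rw [← tendsto_add_atTop_iff_nat 1]
      -- Only the term `s = 0` survives in the limit: the others carry the factor `X ^ (s * (2 * n +
      -- 3))`.
      refine tendsto_zero_of_X_pow_dvd fun n => ?_
      rw [Finset.sum_range_succ']
      have h0 : shanksTerm (X : PowerSeries ℤ) (n + 1) 0 =
          ∏ i ∈ Finset.range (n + 1), (1 - X ^ (2 * (i + 1))) := by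
        rw [shanksTerm, Finset.prod_range_zero, mul_one, zero_mul, pow_zero, mul_one,
          ← Finset.range_eq_Ico]
        rfl
      rw [h0, add_sub_cancel_right]
      refine Finset.dvd_sum fun s _ => ?_
      rw [shanksTerm]
      refine Dvd.dvd.mul_left (pow_dvd_pow _ ?_) _
      nlinarith
    simpa [eulerProd] using
      h.add (multipliable_eulerProd 2 one_le_two).hasProd.tendsto_prod_nat
  have h := tendsto_nhds_unique (h1.congr (sum_pow_triangular_mul_prod X)) h2
  rw [eulerProd_one_eq_mul, ← mul_assoc, h, sq]

theorem dilate_two_dilate_two (f : PowerSeries ℤ) : dilate 2 (dilate 2 f) = dilate 4 f :=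
  dilate_dilate 2 2 f

/-! ### The substitution `q ↦ -q` and Gauss' identity for `φ(-q)`. -/

/-- The substitution `q ↦ -q`. -/
noncomputable abbrev alternate : PowerSeries ℤ →+* PowerSeries ℤ := rescale (-1)

theorem alternate_dilate_two_mul (k : ℕ) [NeZero k] (f : PowerSeries ℤ) :
    alternate (dilate (2 * k) f) = dilate (2 * k) f := by
  ext n
  rw [coeff_rescale, coeff_expand]
  split_ifs with h
  · rw [((even_two_mul k).trans_dvd h).neg_one_pow, one_mul]
  · rw [mul_zero]

theorem alternate_X : alternate X = -X := by
  rw [alternate, rescale_X]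
  simp

theorem alternate_phi_eq : alternate phi = dilate 4 phi - 2 * X * dilate 8 psi := by
  conv_lhs => rw [phi_eq]
  have h4 := alternate_dilate_two_mul 2 phi
  have h8 := alternate_dilate_two_mul 4 psi
  norm_num at h4 h8
  rw [map_add, map_mul, map_mul, alternate_X, map_ofNat, h4, h8]
  ring

theorem alternate_phi_sq : alternate phi ^ 2 = dilate 2 phi ^ 2 - 4 * X * dilate 4 psi ^ 2 := by
  have h2 := alternate_dilate_two_mul 1 phi
  have h4 := alternate_dilate_two_mul 2 psi
  norm_num at h2 h4
  rw [← map_pow, phi_sq, map_add, map_mul, map_mul, map_pow, map_pow, alternate_X, map_ofNat,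
    h2, h4]
  ring

/-- The dissections of `φ(q)` and `φ(-q)` multiply to a difference of squares, which is the
dissection of `φ(-q)^2` at `q^2`. -/
theorem phi_mul_alternate_phi : phi * alternate phi = dilate 2 (alternate phi) ^ 2 := by
  rw [← map_pow, alternate_phi_sq, alternate_phi_eq]
  have h4 := dilate_dilate 2 2 phi
  have h8 := dilate_dilate 2 4 psi
  norm_num at h4 h8
  simp only [map_sub, map_mul, map_pow, map_ofNat, expand_X, h4, h8]
  linear_combination (dilate 4 phi - 2 * X * dilate 8 psi) * phi_eq

/-- A power series with constant coefficient `1` is determined by the ratio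
`f(q) / f(q^2)^2`. -/
theorem eq_of_mul_dilate_two_sq_eq {A B : PowerSeries ℤ} (hA : constantCoeff A = 1)
    (hB : constantCoeff B = 1) (h : A * dilate 2 B ^ 2 = B * dilate 2 A ^ 2) : A = B := by
  by_contra hne
  have hD : A - B ≠ 0 := sub_ne_zero.2 hne
  -- If `A - B` has order `d`, the left side has order `d` and the right side at least `2d`, so `d =
  -- 0`; but the constant terms agree.
  have hmul : (A - B) * dilate 2 A ^ 2 =
      dilate 2 (A - B) * (A * (dilate 2 A + dilate 2 B)) := by
    rw [map_sub]
    linear_combination h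
  have hA' : (dilate 2 A ^ 2).order = 0 := by
    refine order_zero_of_unit ?_
    rw [isUnit_iff_constantCoeff]
    simp [hA]
  have ho := congrArg order hmul
  rw [order_mul, order_mul, hA', add_zero, order_expand] at ho
  obtain ⟨d, hd⟩ := ENat.ne_top_iff_exists.1 (order_eq_top.not.2 hD)
  have hd0 : d ≠ 0 := by
    rintro rfl
    have h1 := (order_ne_zero_iff_constCoeff_eq_zero (φ := A - B)).2 (by simp [hA, hB])
    exact h1 hd.symm
  rw [← hd] at ho
  have hle : ((2 • (d : ℕ∞)) : ℕ∞) ≤ d := by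
    conv_rhs => rw [ho]
    exact le_self_add
  rw [nsmul_eq_mul] at hle
  norm_cast at hle
  omega

theorem constantCoeff_eulerProd_one : constantCoeff (eulerProd 1) = 1 := by
  have h := (multipliable_eulerProd 1 le_rfl).map_tprod (constantCoeff (R := ℤ))
    (WithPiTopology.continuous_constantCoeff ℤ)
  rw [eulerProd, h]
  simp

theorem constantCoeff_phi : constantCoeff phi = 1 := by
  have h := congrArg constantCoeff psi_mul_eulerProd_one
  have h' := congrArg constantCoeff psi_sq
  rw [eulerProd_eq_dilate 2] at h
  simp only [map_mul, map_pow, constantCoeff_expand, constantCoeff_eulerProd_one] at h h'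
  rw [mul_one, one_pow] at h
  rw [h] at h'
  linarith

theorem constantCoeff_alternate (f : PowerSeries ℤ) :
    constantCoeff (alternate f) = constantCoeff f := by
  rw [← coeff_zero_eq_constantCoeff_apply, coeff_rescale, pow_zero, one_mul,
    coeff_zero_eq_constantCoeff_apply]

/-- Gauss' identity `f_1 ^ 2 = f_2 φ(-q)`. -/
theorem eulerProd_one_sq : eulerProd 1 ^ 2 = dilate 2 (eulerProd 1) * alternate phi := by
  have hpsi : psi * eulerProd 1 = dilate 2 (eulerProd 1) ^ 2 := by
    rw [psi_mul_eulerProd_one, eulerProd_eq_dilate 2]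
  have hpsi2 := congrArg (dilate 2) hpsi
  simp only [map_mul, map_pow, dilate_two_dilate_two] at hpsi2
  have hphi : phi ≠ 0 := fun h => by simpa [h] using constantCoeff_phi
  -- The product formula for `φ`, obtained by eliminating `ψ` from `psi_sq` and `ψ f_1 = f_2^2`.
  have hA : phi * eulerProd 1 ^ 2 * dilate 4 (eulerProd 1) ^ 2 = dilate 2 (eulerProd 1) ^ 5 := by
    rw [← hpsi2]
    linear_combination (-(eulerProd 1 ^ 2 * dilate 2 (eulerProd 1))) * psi_sq +
      dilate 2 (eulerProd 1) * (psi * eulerProd 1 + dilate 2 (eulerProd 1) ^ 2) * hpsi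
  refine eq_of_mul_dilate_two_sq_eq (by simp [constantCoeff_eulerProd_one])
    (by rw [map_mul, constantCoeff_alternate, constantCoeff_phi, constantCoeff_expand,
      constantCoeff_eulerProd_one, one_mul]) ?_
  refine mul_left_cancel₀ hphi ?_
  simp only [map_mul, map_pow, dilate_two_dilate_two]
  linear_combination dilate 2 (alternate phi) ^ 2 * hA -
    dilate 2 (eulerProd 1) ^ 5 * phi_mul_alternate_phi

/-! ### The 2-dissection of `f_1^4 f_5^4`. -/

/-- The odd part of `f_1 ^ 4 f_5 ^ 4`. -/
theorem eulerProd_pow_four_dissection : ∃ N : PowerSeries ℤ,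
    eulerProd 1 ^ 4 * eulerProd 5 ^ 4 = dilate 2 N + X * dilate 2
      (-4 * (eulerProd 1 ^ 4 * eulerProd 5 ^ 4 +
        2 * X * dilate 2 (eulerProd 1 ^ 4 * eulerProd 5 ^ 4))) := by
  have hE4 : eulerProd 1 ^ 4 =
      dilate 2 (eulerProd 1) ^ 2 * (dilate 2 phi ^ 2 - 4 * X * dilate 4 psi ^ 2) := by
    rw [← alternate_phi_sq]
    linear_combination (eulerProd 1 ^ 2 + dilate 2 (eulerProd 1) * alternate phi) * eulerProd_one_sq
  have hE4' := congrArg (dilate 5) hE4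
  have hpsi : psi * eulerProd 1 = dilate 2 (eulerProd 1) ^ 2 := by
    rw [psi_mul_eulerProd_one, eulerProd_eq_dilate 2]
  have hpsi5 := congrArg (dilate 5) hpsi
  have hpsi_sq5 := congrArg (dilate 5) psi_sq
  have h5 := eulerProd_mul_dilate_five
  have c1 (f) : dilate 5 (dilate 2 f) = dilate 2 (dilate 5 f) := by
    rw [dilate_dilate, dilate_dilate]
  have c2 (f) : dilate 4 f = dilate 2 (dilate 2 f) := (dilate_dilate 2 2 f).symm
  have c3 (f) : dilate 10 f = dilate 2 (dilate 5 f) := (dilate_dilate 2 5 f).symm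
  simp only [map_mul, map_pow, map_sub, map_ofNat, expand_X, c1, c2, c3] at hE4' hpsi5 hpsi_sq5 h5 hE4
  rw [eulerProd_eq_dilate 5]
  generalize eulerProd 1 = E at *
  generalize dilate 5 E = E5 at *
  -- Put `A = ψ(q^2) φ(q^5)` and `B = q φ(q) ψ(q^10)`. Then `A^2 + B^2 = (A - B)^2 + 2AB`, where `A
  -- - B = f_1 f_5` and `(f_1 f_5)^2 AB = q f_2^4 f_10^4`.
  have hM : -4 * (E ^ 4 * E5 ^ 4 + 2 * X * (dilate 2 E ^ 4 * dilate 2 E5 ^ 4)) =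
      -4 * (E * E5) ^ 2 * (dilate 2 psi ^ 2 * dilate 5 phi ^ 2 +
        X ^ 2 * phi ^ 2 * dilate 2 (dilate 5 psi) ^ 2) := by
    have h2 : dilate 2 E ^ 4 * dilate 2 E5 ^ 4 =
        (E * E5) ^ 2 * (phi * dilate 2 psi) * (dilate 5 phi * dilate 2 (dilate 5 psi)) := by
      rw [← psi_sq, ← hpsi_sq5, show dilate 2 E ^ 4 = (dilate 2 E ^ 2) ^ 2 by ring,
        show dilate 2 E5 ^ 4 = (dilate 2 E5 ^ 2) ^ 2 by ring, ← hpsi, ← hpsi5]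
      ring
    rw [h2, show E ^ 4 * E5 ^ 4 = (E * E5) ^ 2 * (E * E5) ^ 2 by ring]
    linear_combination (-4 * (E * E5) ^ 2) *
      (E * E5 + dilate 2 psi * dilate 5 phi - X * phi * dilate 2 (dilate 5 psi)) * h5
  have hd : dilate 2 (E ^ 4 * E5 ^ 4) = dilate 2 E ^ 4 * dilate 2 E5 ^ 4 := by
    simp only [map_mul, map_pow]
  rw [hd, hM, hE4, hE4']
  -- The even part: products of two even or of two odd pieces of the dissections, with `q^2`
  -- replaced by `q`.
  refine ⟨(E * E5) ^ 2 * (phi ^ 2 * dilate 5 phi ^ 2 +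
    16 * X ^ 3 * dilate 2 psi ^ 2 * dilate 2 (dilate 5 psi) ^ 2), ?_⟩
  simp only [map_mul, map_pow, map_add, map_neg, map_ofNat, expand_X]
  ring

theorem PStar_two_mul_add_one (n : ℕ) :
    PStar (2 * n + 1) = -4 * PStar n - 8 * (if 2 ∣ n + 1 then PStar ((n + 1) / 2 - 1) else 0) := by
  obtain ⟨N, hN⟩ := eulerProd_pow_four_dissection
  have h := congrArg (coeff (2 * n + 1)) hN
  rw [map_add, coeff_expand_of_not_dvd _ _ _ (by omega), coeff_succ_X_mul, coeff_expand_mul,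
    zero_add] at h
  have hC : (-4 : PowerSeries ℤ) = C (-4) := by simp
  rw [hC, coeff_C_mul, map_add, mul_assoc, two_mul (X * _), map_add] at h
  rw [PStar, h]
  rcases n with _ | n
  · simp [PStar]
  · rw [coeff_succ_X_mul, coeff_expand]
    rcases Nat.even_or_odd' n with ⟨c, rfl | rfl⟩
    · rw [if_pos (by omega), if_pos (by omega), PStar, PStar, show 2 * c / 2 = c by omega,
        show (2 * c + 1 + 1) / 2 - 1 = c by omega]
      ring
    · rw [if_neg (by omega), if_neg (by omega), PStar]
      ring

/-! ### The Hecke recurrence at 2 and its consequences. -/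

/-- The coefficients `a(n)` of `q f_1 ^ 4 f_5 ^ 4`. -/
noncomputable def shiftedCoeff (n : ℕ) : ℤ := if n = 0 then 0 else PStar (n - 1)

theorem shiftedCoeff_two_mul_odd (n : ℕ) :
    shiftedCoeff (2 * (2 * n + 1)) = -4 * shiftedCoeff (2 * n + 1) := by
  have h := PStar_two_mul_add_one (2 * n)
  rw [if_neg (by omega)] at h
  simp only [shiftedCoeff]
  rw [if_neg (by omega), if_neg (by omega), show 2 * (2 * n + 1) - 1 = 2 * (2 * n) + 1 by omega, h]
  simp

/-- The Hecke relation at the prime `2`. -/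
theorem shiftedCoeff_four_mul (n : ℕ) :
    shiftedCoeff (2 * (2 * n)) = -4 * shiftedCoeff (2 * n) - 8 * shiftedCoeff n := by
  rcases n with _ | n
  · simp [shiftedCoeff]
  · have h := PStar_two_mul_add_one (2 * n + 1)
    rw [if_pos (by omega)] at h
    simp only [shiftedCoeff]
    rw [if_neg (by omega), if_neg (by omega), if_neg (by omega),
      show 2 * (2 * (n + 1)) - 1 = 2 * (2 * n + 1) + 1 by omega, h]
    congr 3
    omega

theorem exists_shiftedCoeff_two_mul (n : ℕ) :
    ∃ b, shiftedCoeff (2 * n) = -4 * shiftedCoeff n - 8 * b ∧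
      (¬ 2 ∣ n → b = 0) := by
  rcases Nat.even_or_odd' n with ⟨c, rfl | rfl⟩
  · exact ⟨_, shiftedCoeff_four_mul c, fun h => absurd ⟨c, rfl⟩ h⟩
  · exact ⟨0, by rw [shiftedCoeff_two_mul_odd]; ring, fun _ => rfl⟩

/-- Here `b` plays the role of `a(n/2)`; iterating the recurrence, `a(n)` drops out at `8n` and `b`
at `16n`. -/
theorem exists_shiftedCoeff_two_pow_mul (n : ℕ) : ∃ b, (¬ 2 ∣ n → b = 0) ∧
    shiftedCoeff (2 * n) = -4 * shiftedCoeff n - 8 * b ∧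
    shiftedCoeff (4 * n) = 8 * shiftedCoeff n + 32 * b ∧
    shiftedCoeff (8 * n) = -64 * b ∧
    shiftedCoeff (16 * n) = -64 * shiftedCoeff n := by
  obtain ⟨b, h1, hb⟩ := exists_shiftedCoeff_two_mul n
  have h2 := shiftedCoeff_four_mul n
  have h3 := shiftedCoeff_four_mul (2 * n)
  have h4 := shiftedCoeff_four_mul (2 * (2 * n))
  ring_nf at h1 h2 h3 h4 ⊢
  exact ⟨b, hb, by linarith, by linarith, by linarith, by linarith⟩

theorem shiftedCoeff_sixteen_pow_mul (k n : ℕ) :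
    shiftedCoeff (2 ^ (4 * k) * n) = (-64) ^ k * shiftedCoeff n := by
  induction k with
  | zero => simp
  | succ k ih =>
    obtain ⟨_, _, _, _, _, h⟩ := exists_shiftedCoeff_two_pow_mul (2 ^ (4 * k) * n)
    rw [show 2 ^ (4 * (k + 1)) * n = 16 * (2 ^ (4 * k) * n) by ring, h, ih]
    ring

theorem PStar_toNat_eq {z : ℤ} {m : ℕ} (hm : m ≠ 0) (h : z + 1 = m) :
    PStar z.toNat = shiftedCoeff m := by
  rw [shiftedCoeff, if_neg hm]
  congr 1
  omega

theorem two_pow_six_mul_dvd (k : ℕ) : (2 : ℤ) ^ (6 * k) ∣ (-64) ^ k := by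
  rw [pow_mul]
  exact pow_dvd_pow_of_dvd (by norm_num) k

end RestrictedPartitions

open RestrictedPartitions in
theorem theorem1p2 (k : ℕ) (n : ℤ) (hn : -1 ≤ n) :
    RestrictedPartitions.PStar (2 ^ (4 * k) * n + 2 ^ (4 * k + 1) - 1).toNat
        ≡ 0 [ZMOD 2 ^ (6 * k)] ∧
      RestrictedPartitions.PStar (2 ^ (4 * k + 1) * n + 2 ^ (4 * k + 2) - 1).toNat
        ≡ 0 [ZMOD 2 ^ (6 * k + 2)] ∧
      RestrictedPartitions.PStar (2 ^ (4 * k + 2) * n + 2 ^ (4 * k + 3) - 1).toNat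
        ≡ 0 [ZMOD 2 ^ (6 * k + 3)] ∧
      RestrictedPartitions.PStar (2 ^ (4 * k + 3) * n + 2 ^ (4 * k + 4) - 1).toNat
        ≡ 0 [ZMOD 2 ^ (6 * k + 6)] ∧
      RestrictedPartitions.PStar (2 ^ (4 * k + 4) * n + 3 * 2 ^ (4 * k + 3) - 1).toNat = 0 := by
  -- Adding 1 to the first four indices gives a power of 2 times `n + 2`, which is positive as `n ≥
  -- -1`.
  obtain ⟨m, hm⟩ : ∃ m : ℕ, n + 2 = m := ⟨(n + 2).toNat, by omega⟩
  have hm0 : m ≠ 0 := by omega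
  obtain rfl : n = m - 2 := by omega
  obtain ⟨b, -, h2, h4, h8, -⟩ := exists_shiftedCoeff_two_pow_mul m
  -- The last index plus 1 is `2^(4k+3) (2m - 1)`; since `2m - 1` is odd, `b' = 0` and the
  -- coefficient vanishes.
  obtain ⟨b', hb', -, -, h8', -⟩ := exists_shiftedCoeff_two_pow_mul (2 * m - 1)
  rw [hb' (by omega)] at h8'
  have hd := two_pow_six_mul_dvd k
  simp only [Int.modEq_zero_iff_dvd]
  refine ⟨?_, ?_, ?_, ?_, ?_⟩
  · rw [PStar_toNat_eq (m := 2 ^ (4 * k) * m) (by positivity) (by push_cast; ring),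
      shiftedCoeff_sixteen_pow_mul]
    exact hd.mul_right _
  · rw [PStar_toNat_eq (m := 2 ^ (4 * k) * (2 * m)) (by positivity) (by push_cast; ring),
      shiftedCoeff_sixteen_pow_mul, h2, pow_add]
    exact mul_dvd_mul hd ⟨-shiftedCoeff m - 2 * b, by ring⟩
  · rw [PStar_toNat_eq (m := 2 ^ (4 * k) * (4 * m)) (by positivity) (by push_cast; ring),
      shiftedCoeff_sixteen_pow_mul, h4, pow_add]
    exact mul_dvd_mul hd ⟨shiftedCoeff m + 4 * b, by ring⟩
  · rw [PStar_toNat_eq (m := 2 ^ (4 * k) * (8 * m)) (by positivity) (by push_cast; ring),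
      shiftedCoeff_sixteen_pow_mul, h8, pow_add]
    exact mul_dvd_mul hd ⟨-b, by ring⟩
  · rw [PStar_toNat_eq (m := 2 ^ (4 * k) * (8 * (2 * m - 1)))
        (mul_ne_zero (by positivity) (by omega))
        (by push_cast [show 1 ≤ 2 * m by omega]; ring),
      shiftedCoeff_sixteen_pow_mul, h8']
    simp
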